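/- For a probability distribution $D$ on $[N]=\{0,\dots,N-1\}$ ($N\ge 1$) put $D(S)=\sum_{i\in S}D(i)$ for $S\subseteq[N]$ and, if $D(S)>0$, let $D_S$ be the conditional distribution: $D_S(i)=D(i)/D(S)$ for $i\in S$, $D_S(i)=0$ for $i\notin S$. Let $T\ge 1$ be an integer and let $O_D:\mathcal P([N])\times[T]\to[N]$ be a map with $D_S(i)=|\{t\in[T]:O_D(S,t)=i\}|/T$ for all $i\in[N]$ and all $S\subseteq[N]$ with $D(S)>0$. A query to the quantum conditional sampling oracle $\mathsf{QCOND}_D$ applies the unitary $U_D|S\rangle|t\rangle|\beta\rangle=|S\rangle|t\rangle|\beta+O_D(S,t)\bmod N\rangle$, where $S\subseteq[N]$, $t\in[T]$, $\beta\in[N]$. A quantum algorithm making exactly $M$ queries starts in a computational basis state of the oracle registers and a finite-dimensional workspace, alternates unitaries independent of $D$ and $O_D$ with $M$ applications of $U_D$, measures in the computational basis, and outputs a real number determined by the outcome. Theorem. There is a universal constant $c>0$ with the following property. For all $N,T\ge 1$, all $R\subseteq S\subseteq[N]$, all integers $M\ge 0$ and all $\delta\in(0,1]$ there is a quantum algorithm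 $\mathrm{MulEstProbQCond}$, depending only on $N,T,S,R,M,\delta$, that makes exactly $M$ queries to $\mathsf{QCOND}_D$ and whose output $\tilde D_S(R)$ satisfies, for every distribution $D$ on $[N]$ (with a map $O_D$ as above) such that $D(S)>0$ and $D_S(R)>0$, $$\mathbb P\big[\tilde D_S(R)\in[1-\epsilon,1+\epsilon]\,D_S(R)\big]\ \ge\ 1-\delta$$ for every $\epsilon\in(0,1]$ satisfying $$M\ \ge\ \frac{c\,\log(1/\delta)}{\epsilon\sqrt{D_S(R)}}.$$ -/

import Mathlib

noncomputable section

namespace QCond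

/-- The weight `D(S) = ∑_{i ∈ S} D(i)` of a set `S ⊆ [N]`. -/
def weight {N : ℕ} (D : Fin N → ℝ) (S : Finset (Fin N)) : ℝ := ∑ i ∈ S, D i

/-- The conditional distribution `D_S` (meaningful when `D(S) > 0`). -/
def condDist {N : ℕ} (D : Fin N → ℝ) (S : Finset (Fin N)) (i : Fin N) : ℝ :=
  if i ∈ S then D i / weight D S else 0

/-- `O : 𝒫([N]) × [T] → [N]` represents `D`: whenever `D(S) > 0`, the label `O(S, t)` of a
uniformly random `t ∈ [T]` has distribution `D_S`. Nothing is required of `O(S, ·)` if `D(S) = 0`. -/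
def Represents {N T : ℕ} (O : Finset (Fin N) → Fin T → Fin N) (D : Fin N → ℝ) : Prop :=
  ∀ S : Finset (Fin N), 0 < weight D S →
    ∀ i : Fin N, condDist D S i =
      ((Finset.univ.filter fun t : Fin T => O S t = i).card : ℝ) / (T : ℝ)

/-- Computational basis labels `(S, t, β, w)`: the three oracle registers, followed by a
workspace register of dimension `W` on which the oracle acts trivially. -/
abbrev BasisLabel (N T W : ℕ) : Type := Finset (Fin N) × Fin T × Fin N × Fin W

/-- Action of the oracle on labels: `(S, t, β, w) ↦ (S, t, β + O(S, t) mod N, w)`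
(addition in `Fin N` is addition modulo `N`). -/
def oracleLabel {N T W : ℕ} (O : Finset (Fin N) → Fin T → Fin N) (b : BasisLabel N T W) :
    BasisLabel N T W :=
  (b.1, b.2.1, b.2.2.1 + O b.1 b.2.1, b.2.2.2)

/-- The matrix of the oracle `U_D ⊗ 1`: the column of the label `b` is the basis vector with
label `oracleLabel O b`. -/
def oracleMatrix {N T W : ℕ} (O : Finset (Fin N) → Fin T → Fin N) :
    Matrix (BasisLabel N T W) (BasisLabel N T W) ℂ :=
  Matrix.of fun a b => if a = oracleLabel O b then 1 else 0

/-- A quantum query algorithm making exactly `M` queries to a conditional sampling oracle with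
parameters `N` and `T`: a workspace dimension, an initial basis state, unitaries that do not
depend on the oracle (only `gate 0, …, gate M` are ever used), and a real output attached to every
outcome of a final measurement in the computational basis. -/
structure Algorithm (N T M : ℕ) where
  workDim : ℕ
  init : BasisLabel N T workDim
  gate : ℕ → Matrix.unitaryGroup (BasisLabel N T workDim) ℂ
  output : BasisLabel N T workDim → ℝ

/-- The state `G_k U G_{k-1} U ⋯ U G_0 |init⟩` reached after `k` queries. -/
def Algorithm.stateAfter {N T M : ℕ} (A : Algorithm N T M)
    (O : Finset (Fin N) → Fin T → Fin N) : ℕ → BasisLabel N T A.workDim → ℂ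
  | 0 => (A.gate 0).1.mulVec (Pi.single A.init 1)
  | k + 1 => (A.gate (k + 1)).1.mulVec ((oracleMatrix O).mulVec (A.stateAfter O k))

/-- The probability that the output of `A`, after its `M` queries to the oracle given by `O` and
a measurement in the computational basis, lies in `E`. -/
def Algorithm.prob {N T M : ℕ} (A : Algorithm N T M)
    (O : Finset (Fin N) → Fin T → Fin N) (E : Set ℝ) : ℝ :=
  ∑ b, (A.output ⁻¹' E).indicator (fun b => ‖A.stateAfter O M b‖ ^ 2) b

end QCond

end

/-! The proof is amplitude estimation with a tailored superposition of step counts. By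
`weight_condDist`, `p = D_S(R)` is the fraction of labels `t` with `O S t ∈ R`; write `p = sin θ ^
2`. A Grover step costs two queries and rotates by `2θ` (`groverAmp_trig`). The workspace carries
amplitudes `a w`, and branch `w` performs `w` steps. After a Fourier transform, the probability of
outcome `y` is the average of the spectral masses of `a` at `y` for the frequencies `θ` and `-θ`
(`sum_norm_sq_fourier`). The output is `sin (π y / Q) ^ 2`.

Suppose that `a` puts mass `1 - δ` within `r = 200 log (1/δ) / M` of every frequency
(`exists_window`). Since `sin² x - sin² θ = sin (x - θ) sin (x + θ)`, the error is at most `r (r + 2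
sin θ)`, hence at most `ε p` once `3 r ≤ ε √p`, which is the hypothesis on `M` with `c = 600`. As
`r` involves neither `ε` nor `D`, one algorithm serves them all.

The logarithm is obtained from the window, without repetition and medians. The coefficients of `(1 +
X + ⋯ + X^(l-1))^(n+1)` have a power of the Dirichlet kernel as spectrum, with tail at most `e^(-n)`
beyond distance `3 / l`; take `n ≈ log (1/δ)` and `l ≈ M / (2 n)`. For `δ` near `1` the radius must
shrink with `1 - δ`; there a uniform window on a fine grid suffices, the grid point nearest to the
frequency alone having mass `1 - δ`. -/

namespace QCond

open Matrix

/-! ### Unitaries: controlled blocks, phased permutations, diffusion, Fourier transform -/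

/-- A family of unitaries acting on one tensor factor, controlled by the other one. -/
theorem exists_unitary_block {B X Y : Type*} [Fintype B] [DecidableEq B] [Fintype X]
    [DecidableEq X] [Fintype Y] [DecidableEq Y] (e : B ≃ X × Y)
    (V : Y → Matrix.unitaryGroup X ℂ) :
    ∃ U : Matrix.unitaryGroup B ℂ, ∀ (v : B → ℂ) (b : B), U.1.mulVec v b =
      ∑ x, (V (e b).2).1 (e b).1 x * v (e.symm (x, (e b).2)) := by
  refine ⟨⟨(blockDiagonal fun y => (V y).1).submatrix e e, ?_⟩, ?_⟩
  · rw [mem_unitaryGroup_iff, star_eq_conjTranspose, conjTranspose_submatrix,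
      submatrix_mul_equiv, blockDiagonal_conjTranspose, ← blockDiagonal_mul]
    have : (fun k => (V k).1 * (V k).1ᴴ) = (1 : Y → Matrix X X ℂ) := by
      funext k
      exact mem_unitaryGroup_iff.1 (V k).2
    rw [this, blockDiagonal_one, submatrix_one_equiv]
  · intro v b
    simp only [mulVec, dotProduct, submatrix_apply]
    rw [← e.symm.sum_comp, Fintype.sum_prod_type]
    refine Finset.sum_congr rfl fun x _ => ?_
    simp [blockDiagonal_apply]

/-- A permutation of the basis combined with phases. -/
theorem exists_unitary_perm {B : Type*} [Fintype B] [DecidableEq B] (σ : Equiv.Perm B)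
    (f : B → ℂ) (hf : ∀ b, f b * star (f b) = 1) :
    ∃ U : Matrix.unitaryGroup B ℂ, ∀ (v : B → ℂ) (b : B),
      U.1.mulVec v b = f b * v (σ b) := by
  refine ⟨⟨Matrix.of fun a b => if b = σ a then f a else 0, ?_⟩, ?_⟩
  · rw [mem_unitaryGroup_iff]
    ext a b
    rw [mul_apply]
    simp only [star_apply, of_apply, ite_mul, zero_mul, Finset.sum_ite_eq',
      Finset.mem_univ, if_true, EmbeddingLike.apply_eq_iff_eq]
    by_cases h : a = b
    · subst h; simpa using hf a
    · simp [h]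
  · intro v b
    simp [mulVec, dotProduct]

/-- Every unit vector is the image of a given basis vector under a unitary. -/
theorem exists_unitary_column {B : Type*} [Fintype B] [DecidableEq B] (b₀ : B) (ψ : B → ℂ)
    (hψ : ∑ b, ‖ψ b‖ ^ 2 = 1) :
    ∃ U : Matrix.unitaryGroup B ℂ, U.1.mulVec (Pi.single b₀ 1) = ψ := by
  have hn : ‖WithLp.toLp 2 ψ‖ = 1 := by
    rw [EuclideanSpace.norm_eq]
    simp [hψ]
  have ho : Orthonormal ℂ (Set.domRestrict {b₀} fun _ : B => WithLp.toLp 2 ψ) := by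
    refine ⟨fun i => hn, fun i j hij => (hij (Subsingleton.elim i j)).elim⟩
  obtain ⟨b, hb⟩ := ho.exists_orthonormalBasis_extension_of_card_eq
    (by simp : Module.finrank ℂ (EuclideanSpace ℂ B) = Fintype.card B)
  refine ⟨⟨_, (EuclideanSpace.basisFun B ℂ).toMatrix_orthonormalBasis_mem_unitary b⟩, ?_⟩
  ext i
  have := hb b₀ rfl
  simp [Module.Basis.toMatrix_apply, this]

theorem sum_norm_sq_mulVec {B : Type*} [Fintype B] [DecidableEq B] (U : Matrix.unitaryGroup B ℂ)
    (v : B → ℂ) : ∑ b, ‖U.1.mulVec v b‖ ^ 2 = ∑ b, ‖v b‖ ^ 2 := by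
  have key : ∀ w : B → ℂ, ((∑ b, ‖w b‖ ^ 2 : ℝ) : ℂ) = star w ⬝ᵥ w := by
    intro w
    simp only [dotProduct, Complex.ofReal_sum]
    refine Finset.sum_congr rfl fun b _ => ?_
    rw [Pi.star_apply, RCLike.star_def, Complex.conj_mul']
    push_cast; rfl
  have h : star (U.1.mulVec v) ⬝ᵥ U.1.mulVec v = star v ⬝ᵥ v := by
    rw [star_mulVec, dotProduct_mulVec, vecMul_vecMul, ← star_eq_conjTranspose,
      mem_unitaryGroup_iff'.1 U.2, vecMul_one]
  rw [← key, ← key] at h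
  exact_mod_cast h

/-- The Grover diffusion `2 |u⟩⟨u| - 1`, where `u` is the uniform superposition. -/
noncomputable def diffusion (T : ℕ) (hT : 0 < T) : Matrix.unitaryGroup (Fin T) ℂ :=
  ⟨Matrix.of fun i j => 2 / (T : ℂ) - if i = j then 1 else 0, by
    have hT' : (T : ℂ) ≠ 0 := by exact_mod_cast hT.ne'
    rw [mem_unitaryGroup_iff]
    ext i j
    rw [mul_apply]
    have : ∀ x : Fin T, (star (2 / (T : ℂ) - if j = x then 1 else 0)) =
        2 / (T : ℂ) - if j = x then 1 else 0 := by
      intro x; split_ifs <;> simp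
    simp only [star_apply, of_apply, this, mul_sub, sub_mul, Finset.sum_sub_distrib,
      mul_ite, ite_mul, mul_one, one_mul, mul_zero, zero_mul, Finset.sum_ite_eq, Finset.mem_univ, if_true, Finset.sum_const,
      Finset.card_univ, Fintype.card_fin, nsmul_eq_mul, one_apply]
    field_simp
    ring⟩

theorem diffusion_apply (T : ℕ) (hT : 0 < T) (v : Fin T → ℂ) (i : Fin T) :
    ∑ j, (diffusion T hT).1 i j * v j = 2 / (T : ℂ) * ∑ j, v j - v i := by
  simp [diffusion, sub_mul, Finset.mul_sum]

/-- The inverse discrete Fourier transform. -/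
noncomputable def fourier (Q : ℕ) (hQ : 0 < Q) : Matrix.unitaryGroup (Fin Q) ℂ :=
  ⟨Matrix.of fun y j => ((√(Q : ℝ) : ℝ) : ℂ)⁻¹ *
      Complex.exp (((-(2 * (Real.pi * (y : ℕ) / Q)) : ℝ) : ℂ) * Complex.I) ^ (j : ℕ), by
    have hQ' : (Q : ℂ) ≠ 0 := by exact_mod_cast hQ.ne'
    rw [mem_unitaryGroup_iff]
    ext y y'
    rw [mul_apply]
    set z : ℂ := Complex.exp (((-(2 * (Real.pi * (y : ℕ) / Q)) +
      2 * (Real.pi * (y' : ℕ) / Q) : ℝ) : ℂ) * Complex.I) with hz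
    have hterm : ∀ j : Fin Q,
        (Matrix.of fun y j : Fin Q => ((√(Q : ℝ) : ℝ) : ℂ)⁻¹ *
          Complex.exp (((-(2 * (Real.pi * (y : ℕ) / Q)) : ℝ) : ℂ) * Complex.I) ^ (j : ℕ)) y j *
        (star (Matrix.of fun y j : Fin Q => ((√(Q : ℝ) : ℝ) : ℂ)⁻¹ *
          Complex.exp (((-(2 * (Real.pi * (y : ℕ) / Q)) : ℝ) : ℂ) * Complex.I) ^ (j : ℕ))) j y' =
        (Q : ℂ)⁻¹ * z ^ (j : ℕ) := by
      intro j
      have hs : ((√(Q : ℝ) : ℝ) : ℂ)⁻¹ * ((√(Q : ℝ) : ℝ) : ℂ)⁻¹ = (Q : ℂ)⁻¹ := by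
        rw [← mul_inv, ← Complex.ofReal_mul, Real.mul_self_sqrt (Nat.cast_nonneg Q)]
        simp
      simp only [of_apply, star_apply, star_mul', RCLike.star_def, map_inv₀, Complex.conj_ofReal, map_pow,
        ← Complex.exp_conj, map_mul, Complex.conj_I]
      rw [hz, ← hs]
      rw [mul_mul_mul_comm, ← mul_pow, ← Complex.exp_add]
      congr 3
      push_cast; ring
    rw [Finset.sum_congr rfl fun j _ => hterm j, ← Finset.mul_sum,
      Fin.sum_univ_eq_sum_range (fun j => z ^ j) Q, one_apply]
    by_cases h : y = y'
    · subst h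
      have : z = 1 := by rw [hz]; simp
      simp [this, hQ']
    · have hzQ : z ^ Q = 1 := by
        rw [hz, ← Complex.exp_nat_mul, Complex.exp_eq_one_iff]
        refine ⟨(y' : ℤ) - (y : ℤ), ?_⟩
        push_cast; field_simp; ring
      have hz1 : z ≠ 1 := by
        rw [hz, Ne, Complex.exp_eq_one_iff]
        rintro ⟨n, hn⟩
        apply h
        have hpi : (Real.pi : ℂ) ≠ 0 := by exact_mod_cast Real.pi_ne_zero
        have h1 : ((y' : ℕ) : ℂ) - (y : ℕ) = n * Q := by
          push_cast at hn
          have h2 := Complex.I_ne_zero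
          field_simp at hn
          linear_combination hn
        have h3 : ((y' : ℕ) : ℤ) - (y : ℕ) = n * Q := by exact_mod_cast h1
        have h4 := y.2
        have h5 := y'.2
        -- Both indices lie in `[0, Q)`, so their difference is a multiple of `Q` only if it is `0`.
        have h6 : n = 0 := by
          by_contra hne
          rcases lt_or_gt_of_ne hne with h7 | h7
          · nlinarith
          · nlinarith
        subst h6
        ext; omega
      rw [geom_sum_eq hz1, hzQ]
      simp [h]⟩

theorem fourier_mulVec (Q : ℕ) (hQ : 0 < Q) (a : Fin Q → ℂ) (φ : ℝ) (y : Fin Q) :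
    (fourier Q hQ).1.mulVec
        (fun j => a j * Complex.exp (((2 * φ : ℝ) : ℂ) * Complex.I) ^ (j : ℕ)) y =
      ((√(Q : ℝ) : ℝ) : ℂ)⁻¹ * ∑ j : Fin Q, a j *
        Complex.exp (((2 * (φ - Real.pi * (y : ℕ) / Q) : ℝ) : ℂ) * Complex.I) ^ (j : ℕ) := by
  simp only [fourier, mulVec, dotProduct, of_apply, Finset.mul_sum]
  refine Finset.sum_congr rfl fun j _ => ?_
  have : Complex.exp (((2 * (φ - Real.pi * (y : ℕ) / Q) : ℝ) : ℂ) * Complex.I) =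
      Complex.exp (((-(2 * (Real.pi * (y : ℕ) / Q)) : ℝ) : ℂ) * Complex.I) *
      Complex.exp (((2 * φ : ℝ) : ℂ) * Complex.I) := by
    rw [← Complex.exp_add]; congr 1; push_cast; ring
  rw [this, mul_pow]
  ring

theorem norm_exp_mul_I_pow (x : ℝ) (j : ℕ) :
    ‖Complex.exp ((x : ℂ) * Complex.I) ^ j‖ = 1 := by
  rw [norm_pow, Complex.norm_exp_ofReal_mul_I, one_pow]

/-! ### Windows with concentrated spectrum -/

/-- Amplitudes `a` on the workspace whose Fourier transform, for every frequency `φ`, puts weight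
at least `1 - δ` on the grid points `π y / Q` with `|sin (π y / Q - φ)| ≤ r`. -/
def IsWindow (Q : ℕ) (hQ : 0 < Q) (h : ℕ) (r δ : ℝ) (a : Fin Q → ℝ) : Prop :=
  ∑ j, a j ^ 2 = 1 ∧ (∀ j : Fin Q, h < j → a j = 0) ∧
    ∀ φ : ℝ, 1 - δ ≤ ∑ y : Fin Q, if |Real.sin (Real.pi * (y : ℕ) / Q - φ)| ≤ r then
      ‖(fourier Q hQ).1.mulVec
        (fun j => (a j : ℂ) * Complex.exp (((2 * φ : ℝ) : ℂ) * Complex.I) ^ (j : ℕ)) y‖ ^ 2 else 0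

/-- Some grid point `π y / Q` is within `π / (2 Q)` of `φ` modulo `π`. -/
theorem exists_grid_point (Q : ℕ) (hQ : 0 < Q) (φ : ℝ) :
    ∃ (y : Fin Q) (n : ℤ), |φ - Real.pi * (y : ℕ) / Q - n * Real.pi| ≤ Real.pi / (2 * Q) := by
  have hQ' : (0 : ℝ) < Q := by exact_mod_cast hQ
  have hQz : (0 : ℤ) < Q := by exact_mod_cast hQ
  -- The nearest grid index over all integers; its remainder modulo `Q` is `y`, its quotient counts
  -- the half turns `n`.
  set m : ℤ := round (φ * Q / Real.pi) with hm
  have h0 := Int.emod_nonneg m hQz.ne'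
  have h1 := Int.emod_lt_of_pos m hQz
  refine ⟨⟨(m % Q).toNat, by omega⟩, m / Q, ?_⟩
  have h2 : (((m % Q).toNat : ℕ) : ℝ) = (m : ℝ) - Q * ((m / Q : ℤ) : ℝ) := by
    have h3 : (((m % Q).toNat : ℕ) : ℤ) = m - Q * (m / Q) := by
      rw [Int.toNat_of_nonneg h0, Int.emod_def]
    exact_mod_cast h3
  have h4 := abs_sub_round (φ * Q / Real.pi)
  rw [← hm] at h4
  have hpi := Real.pi_pos
  have h5 : φ - Real.pi * (((m % Q).toNat : ℕ) : ℝ) / Q - ((m / Q : ℤ) : ℝ) * Real.pi =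
      (φ * Q / Real.pi - m) * (Real.pi / Q) := by
    rw [h2]; field_simp; ring
  simp only [h5]
  rw [abs_mul, abs_of_pos (div_pos hpi hQ')]
  calc _ ≤ 1 / 2 * (Real.pi / Q) := by gcongr
    _ = _ := by field_simp

/-- All the phases have angle at most `1`, so each real part is at least `1 - 1/2` and no
cancellation occurs. -/
theorem norm_sum_exp_ge (m : ℕ) (u : ℝ) (hu : m * |u| ≤ 1) :
    (m : ℝ) / 2 ≤ ‖∑ j : Fin m, Complex.exp ((u : ℂ) * Complex.I) ^ (j : ℕ)‖ := by
  refine le_trans ?_ (Complex.re_le_norm _)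
  rw [Complex.re_sum]
  have : ∀ j : Fin m, (1 : ℝ) / 2 ≤ (Complex.exp ((u : ℂ) * Complex.I) ^ (j : ℕ)).re := by
    intro j
    rw [← Complex.exp_nat_mul]
    have : ((j : ℕ) : ℂ) * ((u : ℂ) * Complex.I) = (((j : ℕ) * u : ℝ) : ℂ) * Complex.I := by
      push_cast; ring
    rw [this, Complex.exp_ofReal_mul_I_re]
    have h1 : |((j : ℕ) : ℝ) * u| ≤ 1 := by
      rw [abs_mul, Nat.abs_cast]
      refine le_trans ?_ hu
      gcongr
      exact j.2.le
    have h2 := Real.one_sub_sq_div_two_le_cos (x := (j : ℕ) * u)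
    have h3 := (sq_le_one_iff_abs_le_one _).2 h1
    linarith
  calc (m : ℝ) / 2 = ∑ j : Fin m, (1 : ℝ) / 2 := by simp; ring
    _ ≤ _ := Finset.sum_le_sum fun j _ => this j

theorem sum_fin_ite_lt {E : Type*} [AddCommMonoid E] {m Q : ℕ} (hmQ : m ≤ Q) (f : ℕ → E) :
    ∑ j : Fin Q, (if (j : ℕ) < m then f j else 0) = ∑ j : Fin m, f j := by
  rw [Fin.sum_univ_eq_sum_range (fun j => if j < m then f j else 0) Q,
    Fin.sum_univ_eq_sum_range f m, ← Finset.sum_filter]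
  congr 1
  ext j; simp; omega

theorem norm_sq_inv_sqrt (x : ℝ) (hx : 0 ≤ x) : ‖((√x : ℝ) : ℂ)⁻¹‖ ^ 2 = x⁻¹ := by
  rw [← Complex.ofReal_inv, Complex.norm_real, Real.norm_eq_abs, sq_abs, inv_pow, Real.sq_sqrt hx]

/-- The uniform window, with success probability `η` at distance `4 π η / (h + 1)`. -/
theorem exists_window_of_small (h : ℕ) (η r : ℝ) (hη : 0 < η) (hη' : η ≤ 1 / 16)
    (hr : 4 * Real.pi * η / (h + 1) ≤ r) :
    ∃ (Q : ℕ) (hQ : 0 < Q) (a : Fin Q → ℝ), IsWindow Q hQ h r (1 - η) a := by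
  have hpi := Real.pi_pos
  have hm : (0 : ℝ) < h + 1 := by positivity
  -- The nearest grid point will have mass at least `(h + 1) / (4 Q)`, so `Q ≤ x` is what makes it
  -- at least `η`, while `Q ≥ x / 2` keeps the grid fine enough for `r`.
  set x : ℝ := (h + 1) / (4 * η) with hx
  have hx4 : 4 * (h + 1 : ℝ) ≤ x := by
    rw [hx, le_div_iff₀ (by positivity)]; nlinarith
  set Q := ⌊x⌋₊ with hQdef
  have hQx : (Q : ℝ) ≤ x := Nat.floor_le (by positivity)
  have hQ4 : 4 * (h + 1) ≤ Q := Nat.le_floor (by push_cast; exact hx4)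
  have hQ4' : 4 * (h + 1 : ℝ) ≤ Q := by exact_mod_cast hQ4
  have hQ : 0 < Q := by omega
  have hQ' : (0 : ℝ) < Q := by exact_mod_cast hQ
  have hQx2 : x / 2 ≤ Q := by
    have := Nat.lt_floor_add_one x
    rw [← hQdef] at this
    linarith
  have hgrid : Real.pi / (2 * Q) ≤ r := by
    refine le_trans ?_ hr
    have h1 : (h + 1 : ℝ) ≤ 8 * η * Q := by
      have : x / 2 * (8 * η) = h + 1 := by rw [hx]; field_simp; ring
      nlinarith
    rw [div_le_div_iff₀ (by positivity) hm]
    nlinarith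
  refine ⟨Q, hQ, fun j => if (j : ℕ) < h + 1 then (√(h + 1 : ℝ))⁻¹ else 0, ?_, ?_, ?_⟩
  · simp only [ite_pow, inv_pow, Real.sq_sqrt hm.le]
    rw [show (0 : ℝ) ^ 2 = 0 by norm_num,
      sum_fin_ite_lt (by omega) (fun _ => (h + 1 : ℝ)⁻¹)]
    simp [hm.ne']
  · intro j hj
    exact if_neg (by omega)
  · intro φ
    obtain ⟨y, n, hyn⟩ := exists_grid_point Q hQ φ
    refine le_trans ?_ (Finset.single_le_sum (f := fun y : Fin Q =>
      if |Real.sin (Real.pi * (y : ℕ) / Q - φ)| ≤ r then _ else 0)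
      (fun y _ => by split_ifs <;> positivity) (Finset.mem_univ y))
    set u := φ - Real.pi * (y : ℕ) / Q - n * Real.pi with hu
    have hsin : |Real.sin (Real.pi * (y : ℕ) / Q - φ)| ≤ r := by
      have : Real.pi * (y : ℕ) / Q - φ = -(u + n * Real.pi) := by rw [hu]; ring
      rw [this, Real.sin_neg, abs_neg, Real.sin_add_int_mul_pi, abs_mul]
      refine le_trans ?_ (hyn.trans hgrid)
      rw [abs_zpow, abs_neg, abs_one, _root_.one_zpow, one_mul]
      exact Real.abs_sin_le_abs
    rw [if_pos hsin, fourier_mulVec]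
    have hexp : Complex.exp (((2 * (φ - Real.pi * (y : ℕ) / Q) : ℝ) : ℂ) * Complex.I) =
        Complex.exp (((2 * u : ℝ) : ℂ) * Complex.I) := by
      rw [Complex.exp_eq_exp_iff_exists_int]
      refine ⟨n, ?_⟩
      rw [hu]; push_cast; ring
    rw [hexp]
    have hsum : ∑ j : Fin Q, (((if (j : ℕ) < h + 1 then (√(h + 1 : ℝ))⁻¹ else 0 : ℝ)) : ℂ) *
        Complex.exp (((2 * u : ℝ) : ℂ) * Complex.I) ^ (j : ℕ) =
        (((√(h + 1 : ℝ))⁻¹ : ℝ) : ℂ) *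
          ∑ j : Fin (h + 1), Complex.exp (((2 * u : ℝ) : ℂ) * Complex.I) ^ (j : ℕ) := by
      rw [← sum_fin_ite_lt (m := h + 1) (Q := Q) (by omega)
        (fun j => Complex.exp (((2 * u : ℝ) : ℂ) * Complex.I) ^ j), Finset.mul_sum]
      refine Finset.sum_congr rfl fun j _ => ?_
      split_ifs <;> simp
    rw [hsum, norm_mul, norm_mul, mul_pow, mul_pow]
    have hge := norm_sum_exp_ge (h + 1) (2 * u) (by
      rw [abs_mul, abs_two]
      have h1 : (2 : ℝ) * |u| ≤ Real.pi / Q := by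
        calc (2 : ℝ) * |u| ≤ 2 * (Real.pi / (2 * Q)) := by gcongr
          _ = _ := by field_simp
      calc ((h + 1 : ℕ) : ℝ) * (2 * |u|) ≤ (h + 1) * (Real.pi / Q) := by push_cast; gcongr
        _ ≤ 1 := by
          rw [mul_div_assoc', div_le_one hQ']
          nlinarith [Real.pi_le_four])
    have h2 : ‖(((√(h + 1 : ℝ))⁻¹ : ℝ) : ℂ)‖ ^ 2 = (h + 1 : ℝ)⁻¹ := by
      rw [Complex.norm_real, Real.norm_eq_abs, sq_abs, inv_pow, Real.sq_sqrt hm.le]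
    rw [norm_sq_inv_sqrt _ hQ'.le, h2]
    push_cast at hge
    calc 1 - (1 - η) = η := by ring
      _ ≤ (Q : ℝ)⁻¹ * ((h + 1 : ℝ)⁻¹ * ((h + 1) / 2) ^ 2) := by
        have : η * Q ≤ (h + 1) / 4 := by
          have : x * (4 * η) = h + 1 := by rw [hx]; field_simp
          nlinarith
        rw [inv_mul_eq_div, le_div_iff₀ hQ']
        refine this.trans_eq ?_
        field_simp; ring
      _ ≤ _ := by push_cast; gcongr

/-- Off the diagonal the Dirichlet kernel is at most `1 / |sin|`. -/
theorem norm_dirichlet_le (l : ℕ) (u : ℝ) :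
    ‖∑ i ∈ Finset.range l, Complex.exp (((2 * u : ℝ) : ℂ) * Complex.I) ^ i‖ * |Real.sin u| ≤ 1 := by
  set z := Complex.exp (((2 * u : ℝ) : ℂ) * Complex.I) with hz
  have h1 : ‖z - 1‖ = 2 * |Real.sin u| := by
    rw [hz, mul_comm, Complex.norm_exp_I_mul_ofReal_sub_one]
    simp
  have h2 : ‖z ^ l - 1‖ ≤ 2 := by
    refine (norm_sub_le _ _).trans ?_
    rw [norm_exp_mul_I_pow, norm_one]; norm_num
  rw [← geom_sum_mul, norm_mul, h1] at h2
  linarith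

/-- Parseval for the Dirichlet kernel on the grid. -/
theorem sum_norm_sq_dirichlet (Q l : ℕ) (hQ : 0 < Q) (hl : l ≤ Q) (φ : ℝ) :
    ∑ y : Fin Q, (Q : ℝ)⁻¹ * ‖∑ i ∈ Finset.range l,
      Complex.exp (((2 * (φ - Real.pi * (y : ℕ) / Q) : ℝ) : ℂ) * Complex.I) ^ i‖ ^ 2 = l := by
  have h := sum_norm_sq_mulVec (fourier Q hQ) (fun j => (if (j : ℕ) < l then 1 else 0 : ℂ) *
    Complex.exp (((2 * φ : ℝ) : ℂ) * Complex.I) ^ (j : ℕ))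
  simp only [fourier_mulVec, norm_mul, mul_pow, norm_sq_inv_sqrt _ (Nat.cast_nonneg Q),
    norm_exp_mul_I_pow] at h
  simp only [ite_mul, one_mul, zero_mul] at h
  have h' : ∀ y : Fin Q, ∑ j : Fin Q, (if (j : ℕ) < l then
      Complex.exp (((2 * (φ - Real.pi * (y : ℕ) / Q) : ℝ) : ℂ) * Complex.I) ^ (j : ℕ) else 0) =
      ∑ i ∈ Finset.range l,
        Complex.exp (((2 * (φ - Real.pi * (y : ℕ) / Q) : ℝ) : ℂ) * Complex.I) ^ i := fun y => by
    rw [← Fin.sum_univ_eq_sum_range (fun i =>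
      Complex.exp (((2 * (φ - Real.pi * (y : ℕ) / Q) : ℝ) : ℂ) * Complex.I) ^ i) l]
    exact sum_fin_ite_lt hl _
  simp only [h'] at h
  rw [h]
  have : ∀ j : Fin Q, ‖(if (j : ℕ) < l then (1 : ℂ) else 0)‖ ^ 2 * 1 ^ 2 =
      if (j : ℕ) < l then (1 : ℝ) else 0 := fun j => by split_ifs <;> simp
  rw [Finset.sum_congr rfl fun j _ => this j, sum_fin_ite_lt hl (fun _ => (1 : ℝ))]
  simp

/-- Powers of the Dirichlet kernel give windows with an exponentially small tail. -/
theorem exists_window_of_power (h n l : ℕ) (r δ : ℝ) (hn : (n + 1) * (l - 1) ≤ h)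
    (hl : h + 1 ≤ l * (n + 1)) (hr : 3 ≤ l * r) (hδ : Real.exp (-n) ≤ δ) :
    ∃ (Q : ℕ) (hQ : 0 < Q) (a : Fin Q → ℝ), IsWindow Q hQ h r δ a := by
  classical
  set Q := h + 1 with hQdef
  have hQ : 0 < Q := by omega
  have hQ' : (0 : ℝ) < Q := by exact_mod_cast hQ
  have hl0 : 0 < l := by
    rcases Nat.eq_zero_or_pos l with h0 | h0
    · subst h0; omega
    · exact h0
  have hl0' : (0 : ℝ) < l := by exact_mod_cast hl0
  have hlQ : l ≤ Q := by
    have : 1 * (l - 1) ≤ (n + 1) * (l - 1) := Nat.mul_le_mul_right _ (by omega)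
    omega
  have hr0 : 0 < r := by
    by_contra hcon
    nlinarith
  -- The degree `(n + 1) (l - 1)` is at most `h`, so the coefficients fit in `Q = h + 1` places.
  set p : Polynomial ℝ := (∑ i ∈ Finset.range l, Polynomial.X ^ i) ^ (n + 1) with hp
  have hdeg : p.natDegree < Q := by
    have h1 : (∑ i ∈ Finset.range l, (Polynomial.X : Polynomial ℝ) ^ i).natDegree ≤ l - 1 := by
      refine Polynomial.natDegree_sum_le_of_forall_le _ _ fun i hi => ?_
      rw [Polynomial.natDegree_X_pow]
      have := Finset.mem_range.1 hi
      omega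
    have h2 : p.natDegree ≤ (n + 1) * (l - 1) :=
      Polynomial.natDegree_pow_le.trans (Nat.mul_le_mul_left _ h1)
    omega
  set b : ℕ → ℝ := p.coeff with hb
  have hbC : ∀ z : ℂ, ∑ j : Fin Q, (b j : ℂ) * z ^ (j : ℕ) =
      (∑ i ∈ Finset.range l, z ^ i) ^ (n + 1) := by
    intro z
    have h1 := Polynomial.aeval_eq_sum_range' hdeg z
    rw [Fin.sum_univ_eq_sum_range (fun j => (b j : ℂ) * z ^ j) Q]
    simp only [hp, map_pow, map_sum, Polynomial.aeval_X] at h1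
    rw [h1]
    refine Finset.sum_congr rfl fun i _ => ?_
    rw [Complex.real_smul]
  have hb1 : ∑ j : Fin Q, b j = (l : ℝ) ^ (n + 1) := by
    have := hbC 1
    simp only [one_pow, mul_one, Finset.sum_const, Finset.card_range, nsmul_eq_mul] at this
    exact_mod_cast this
  set B := ∑ j : Fin Q, b j ^ 2 with hB
  -- Cauchy–Schwarz bounds the normalisation from below by the value of the polynomial at `1`.
  have hBge : ((l : ℝ) ^ (n + 1)) ^ 2 ≤ Q * B := by
    have := sq_sum_le_card_mul_sum_sq (s := Finset.univ) (f := fun j : Fin Q => b j)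
    rwa [hb1, Finset.card_univ, Fintype.card_fin] at this
  have hB0 : 0 < B := by
    have : 0 < ((l : ℝ) ^ (n + 1)) ^ 2 := by positivity
    by_contra hcon
    nlinarith
  have hsum1 : ∑ j : Fin Q, ((√B)⁻¹ * b j) ^ 2 = 1 := by
    simp only [mul_pow, ← Finset.mul_sum, inv_pow, Real.sq_sqrt hB0.le]
    exact inv_mul_cancel₀ hB0.ne'
  refine ⟨Q, hQ, fun j => (√B)⁻¹ * b j, hsum1, fun j hj => ?_, fun φ => ?_⟩
  · exact absurd j.2 (by omega)
  · set F : Fin Q → ℝ := fun y => ‖(fourier Q hQ).1.mulVec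
        (fun j => (((√B)⁻¹ * b j : ℝ) : ℂ) *
          Complex.exp (((2 * φ : ℝ) : ℂ) * Complex.I) ^ (j : ℕ)) y‖ ^ 2 with hF
    have htot : ∑ y, F y = 1 := by
      rw [hF, sum_norm_sq_mulVec, ← hsum1]
      refine Finset.sum_congr rfl fun j _ => ?_
      rw [norm_mul, norm_exp_mul_I_pow, mul_one, Complex.norm_real, Real.norm_eq_abs, sq_abs]
    set G : Fin Q → ℝ := fun y => ‖∑ i ∈ Finset.range l,
      Complex.exp (((2 * (φ - Real.pi * (y : ℕ) / Q) : ℝ) : ℂ) * Complex.I) ^ i‖ with hG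
    have hFG : ∀ y, F y = B⁻¹ * (G y ^ n) ^ 2 * ((Q : ℝ)⁻¹ * G y ^ 2) := by
      intro y
      rw [hF]
      simp only [fourier_mulVec]
      have : ∑ j : Fin Q, (((√B)⁻¹ * b j : ℝ) : ℂ) *
          Complex.exp (((2 * (φ - Real.pi * (y : ℕ) / Q) : ℝ) : ℂ) * Complex.I) ^ (j : ℕ) =
          ((√B : ℝ) : ℂ)⁻¹ * (∑ i ∈ Finset.range l,
      Complex.exp (((2 * (φ - Real.pi * (y : ℕ) / Q) : ℝ) : ℂ) * Complex.I) ^ i) ^ (n + 1) := by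
        rw [← hbC, Finset.mul_sum]
        refine Finset.sum_congr rfl fun j _ => ?_
        push_cast; ring
      rw [this, norm_mul, norm_mul, mul_pow, mul_pow, norm_sq_inv_sqrt _ hB0.le,
        norm_sq_inv_sqrt _ hQ'.le, norm_pow]
      simp only [hG]
      ring
    -- Outside the window, `n` of the `n + 1` kernel factors are bounded by `1 / r`. The last one is
    -- kept, so that Parseval sums it to `l` and no factor `Q` is lost.
    have hpt : ∀ y, F y - (if |Real.sin (Real.pi * (y : ℕ) / Q - φ)| ≤ r then F y else 0) ≤
        B⁻¹ * ((r⁻¹) ^ n) ^ 2 * ((Q : ℝ)⁻¹ * G y ^ 2) := by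
      intro y
      split_ifs with hc
      · rw [sub_self]; positivity
      · rw [sub_zero, hFG]
        have h1 := norm_dirichlet_le l (φ - Real.pi * (y : ℕ) / Q)
        rw [← neg_sub, Real.sin_neg, abs_neg] at hc
        push Not at hc
        have h2 : G y ≤ r⁻¹ := by
          rw [← one_div, le_div_iff₀ hr0]
          exact (mul_le_mul_of_nonneg_left hc.le (norm_nonneg _)).trans h1
        have h3 : 0 ≤ G y := norm_nonneg _
        gcongr
    have hsub := Finset.sum_le_sum fun y (_ : y ∈ Finset.univ) => hpt y
    rw [Finset.sum_sub_distrib, htot, ← Finset.mul_sum,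
      sum_norm_sq_dirichlet Q l hQ hlQ φ] at hsub
    -- With `Q ≤ l (n + 1)` and `l r ≥ 3`, the tail is at most `(n + 1) / 9 ^ n ≤ (2 / 9) ^ n ≤ 3 ^
    -- (-n) ≤ e ^ (-n)`.
    have htail : B⁻¹ * ((r⁻¹) ^ n) ^ 2 * l ≤ δ := by
      refine le_trans ?_ hδ
      have e1 : (Q : ℝ) ≤ l * (n + 1) := by exact_mod_cast hl
      have e2 : (n + 1 : ℝ) ≤ 2 ^ n := by exact_mod_cast Nat.lt_two_pow_self (n := n)
      have e3 : Real.exp (-n) * 3 ^ n ≥ 1 := by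
        rw [Real.exp_neg, ← div_eq_inv_mul, ge_iff_le, le_div_iff₀ (Real.exp_pos _), one_mul,
          ← Real.exp_one_pow]
        gcongr
        exact Real.exp_one_lt_three.le
      have e4 : (9 : ℝ) ^ n ≤ ((l : ℝ) ^ n * r ^ n) ^ 2 := by
        rw [← mul_pow, ← pow_mul, mul_comm n 2, pow_mul]
        gcongr
        nlinarith
      have e5 : (l : ℝ) ^ 2 * ((l : ℝ) ^ n) ^ 2 ≤ l * (n + 1) * B := by
        calc (l : ℝ) ^ 2 * ((l : ℝ) ^ n) ^ 2 = ((l : ℝ) ^ (n + 1)) ^ 2 := by ring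
          _ ≤ Q * B := hBge
          _ ≤ _ := by gcongr
      have e6 : (l : ℝ) * ((l : ℝ) ^ n) ^ 2 ≤ (n + 1) * B := by
        refine le_of_mul_le_mul_left ?_ hl0'
        linarith
      have e7 : (l : ℝ) * 9 ^ n ≤ 2 ^ n * (B * (r ^ n) ^ 2) := by
        calc (l : ℝ) * 9 ^ n ≤ l * ((l : ℝ) ^ n * r ^ n) ^ 2 := by gcongr
          _ = l * ((l : ℝ) ^ n) ^ 2 * (r ^ n) ^ 2 := by ring
          _ ≤ (n + 1) * B * (r ^ n) ^ 2 := by gcongr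
          _ ≤ 2 ^ n * B * (r ^ n) ^ 2 := by gcongr
          _ = _ := by ring
      have e9 : (l : ℝ) * 3 ^ n ≤ B * (r ^ n) ^ 2 := by
        have h1 : (l : ℝ) * 6 ^ n ≤ l * 9 ^ n := by gcongr; norm_num
        have h2 : (6 : ℝ) ^ n = 2 ^ n * 3 ^ n := by rw [← mul_pow]; norm_num
        rw [h2] at h1
        have h3 : (0 : ℝ) < 2 ^ n := by positivity
        refine le_of_mul_le_mul_left ?_ h3
        linarith
      have e10 : (l : ℝ) ≤ Real.exp (-n) * (B * (r ^ n) ^ 2) := by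
        calc (l : ℝ) = l * 1 := (mul_one _).symm
          _ ≤ l * (Real.exp (-n) * 3 ^ n) := by gcongr
          _ = Real.exp (-n) * (l * 3 ^ n) := by ring
          _ ≤ _ := by gcongr
      have : B⁻¹ * ((r⁻¹) ^ n) ^ 2 * l = l / (B * (r ^ n) ^ 2) := by
        rw [inv_pow, inv_pow]; field_simp
      rw [this, div_le_iff₀ (by positivity)]
      exact e10
    show 1 - δ ≤ ∑ y : Fin Q, if |Real.sin (Real.pi * (y : ℕ) / Q - φ)| ≤ r then F y else 0
    linarith

/-- The support bound `M / 2` reflects two queries per Grover step. The two regimes of `δ` need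
different windows because `⌈log (1/δ)⌉` is comparable to `log (1/δ)` only when the latter is bounded
below. -/
theorem exists_window (M : ℕ) (hM : 0 < M) (δ : ℝ) (hδ : 0 < δ) (hδ1 : δ < 1) :
    ∃ (Q : ℕ) (hQ : 0 < Q) (a : Fin Q → ℝ),
      IsWindow Q hQ (M / 2) (200 * Real.log (1 / δ) / M) δ a := by
  have hM' : (0 : ℝ) < M := by exact_mod_cast hM
  have hh : (M : ℝ) ≤ 2 * ((M / 2 : ℕ) + 1) := by
    have : M ≤ 2 * (M / 2 + 1) := by omega
    exact_mod_cast this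
  have hL : 1 - δ ≤ Real.log (1 / δ) := by
    rw [one_div, Real.log_inv]
    have := Real.log_le_sub_one_of_pos hδ
    linarith
  set L := Real.log (1 / δ) with hLdef
  by_cases hc : 1 - δ ≤ 1 / 16
  · have := exists_window_of_small (M / 2) (1 - δ) (200 * L / M) (by linarith) hc (by
      rw [div_le_div_iff₀ (by positivity) hM']
      have h1 := Real.pi_le_four
      have h2 := Real.pi_pos
      calc 4 * Real.pi * (1 - δ) * M ≤ 4 * 4 * L * (2 * ((M / 2 : ℕ) + 1)) := by gcongr; linarith
        _ ≤ _ := by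
          have : 0 ≤ L * (((M / 2 : ℕ) : ℝ) + 1) := mul_nonneg (by linarith) (by positivity)
          nlinarith)
    rwa [sub_sub_cancel] at this
  · push Not at hc
    have hL' : 1 / 16 ≤ L := by linarith
    set n := ⌈L⌉₊ with hn
    have hn1 : L ≤ n := Nat.le_ceil L
    have hn2 : (n : ℝ) < L + 1 := Nat.ceil_lt_add_one (by linarith)
    have hlt : M / 2 < (n + 1) * (M / 2 / (n + 1) + 1) := Nat.lt_mul_div_succ _ (by omega)
    refine exists_window_of_power (M / 2) n (M / 2 / (n + 1) + 1) _ δ ?_ ?_ ?_ ?_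
    · simpa using Nat.mul_div_le (M / 2) (n + 1)
    · rw [mul_comm]; omega
    · have h1 : ((M / 2 : ℕ) : ℝ) + 1 ≤ (n + 1) * ((M / 2 / (n + 1) + 1 : ℕ) : ℝ) := by
        exact_mod_cast hlt
      set l : ℝ := ((M / 2 / (n + 1) + 1 : ℕ) : ℝ) with hldef
      have hl0 : 0 ≤ l := Nat.cast_nonneg _
      -- Here `n + 1 < L + 2 ≤ 33 L` because `L ≥ 1/16`; then `3 M ≤ 198 L l`, whence the constant
      -- `200`.
      have h2 : (M : ℝ) ≤ 66 * L * l := by nlinarith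
      rw [mul_div_assoc', le_div_iff₀ hM']
      nlinarith
    · rw [Real.exp_neg, inv_le_comm₀ (Real.exp_pos _) hδ, ← one_div,
        ← Real.exp_log (show 0 < 1 / δ by positivity)]
      exact Real.exp_le_exp.2 hn1

/-! ### Gates and queries acting on branch states -/

/-- Any algorithm can be followed by a fixed unitary at the cost of no further query. -/
theorem exists_algorithm_postcompose {N T M Q : ℕ} (init : BasisLabel N T Q)
    (g : ℕ → Matrix.unitaryGroup (BasisLabel N T Q) ℂ)
    (V : Matrix.unitaryGroup (BasisLabel N T Q) ℂ) (out : BasisLabel N T Q → ℝ) :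
    ∃ g' : ℕ → Matrix.unitaryGroup (BasisLabel N T Q) ℂ, ∀ O,
      (Algorithm.mk Q init g' out : Algorithm N T M).stateAfter O M =
        V.1.mulVec ((Algorithm.mk Q init g out : Algorithm N T M).stateAfter O M) := by
  refine ⟨fun k => if k = M then V * g k else g k, fun O => ?_⟩
  have hlt : ∀ k, k < M → (Algorithm.mk Q init (fun k => if k = M then V * g k else g k) out :
      Algorithm N T M).stateAfter O k =
      (Algorithm.mk Q init g out : Algorithm N T M).stateAfter O k := by
    intro k
    induction k with
    | zero => intro h; simp [Algorithm.stateAfter, h.ne]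
    | succ k ih => intro h; simp [Algorithm.stateAfter, h.ne, ih (by omega)]
  cases M with
  | zero =>
    simp only [Algorithm.stateAfter, if_true]
    exact (mulVec_mulVec _ _ _).symm
  | succ m =>
    simp only [Algorithm.stateAfter, if_true, hlt m (by omega)]
    exact (mulVec_mulVec _ _ _).symm

/-- The amplitude `u w t` on the labels `(S, t, f t, w)`. -/
def branchState {N T Q : ℕ} (S : Finset (Fin N)) (f : Fin T → Fin N) (u : Fin Q → Fin T → ℂ) :
    BasisLabel N T Q → ℂ :=
  fun b => if b.1 = S ∧ b.2.2.1 = f b.2.1 then u b.2.2.2 b.2.1 else 0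

/-- A query only changes the function tying `β` to `t`, so the amplitudes `u` can be tracked
separately from the oracle registers. -/
theorem oracleMatrix_mulVec {N T Q : ℕ} [NeZero N] (O : Finset (Fin N) → Fin T → Fin N)
    (S : Finset (Fin N)) (f : Fin T → Fin N) (u : Fin Q → Fin T → ℂ) :
    (oracleMatrix O).mulVec (branchState S f u) = branchState S (fun t => f t + O S t) u := by
  funext b
  have : ∀ x : BasisLabel N T Q, b = oracleLabel O x ↔
      x = (b.1, b.2.1, b.2.2.1 - O b.1 b.2.1, b.2.2.2) := by
    rintro ⟨x1, x2, x3, x4⟩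
    obtain ⟨b1, b2, b3, b4⟩ := b
    simp only [oracleLabel, Prod.mk.injEq]
    constructor
    · rintro ⟨rfl, rfl, rfl, rfl⟩; simp
    · rintro ⟨rfl, rfl, rfl, rfl⟩; simp
  simp only [mulVec, dotProduct, oracleMatrix, of_apply, this, ite_mul, one_mul, zero_mul,
    Finset.sum_ite_eq', Finset.mem_univ, if_true, branchState]
  refine if_congr (and_congr_right fun h => ?_) rfl rfl
  rw [h, sub_eq_iff_eq_add]

theorem exists_fourier_gate (N T Q : ℕ) (hQ : 0 < Q) :
    ∃ V : Matrix.unitaryGroup (BasisLabel N T Q) ℂ, ∀ (S : Finset (Fin N)) (f : Fin T → Fin N)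
      (u : Fin Q → Fin T → ℂ), V.1.mulVec (branchState S f u) =
        branchState S f fun y t => (fourier Q hQ).1.mulVec (fun w => u w t) y := by
  let e : BasisLabel N T Q ≃ Fin Q × (Finset (Fin N) × Fin T × Fin N) :=
    ⟨fun b => (b.2.2.2, b.1, b.2.1, b.2.2.1), fun x => (x.2.1, x.2.2.1, x.2.2.2, x.1),
      fun _ => rfl, fun _ => rfl⟩
  obtain ⟨V, hV⟩ := exists_unitary_block e fun _ => fourier Q hQ
  refine ⟨V, fun S f u => ?_⟩
  funext b
  rw [hV]
  simp only [e, branchState, Equiv.coe_fn_mk, Equiv.coe_fn_symm_mk]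
  split_ifs
  · rfl
  · simp

/-- The diffusion on the register `t`, applied when the workspace label exceeds `k`. -/
theorem exists_diffusion_gate (N T Q : ℕ) (hT : 0 < T) (k : ℕ) :
    ∃ V : Matrix.unitaryGroup (BasisLabel N T Q) ℂ, ∀ (S : Finset (Fin N)) (c : Fin N)
      (u : Fin Q → Fin T → ℂ), V.1.mulVec (branchState S (fun _ => c) u) =
        branchState S (fun _ => c) fun w t =>
          if k < (w : ℕ) then 2 / (T : ℂ) * ∑ x, u w x - u w t else u w t := by
  let e : BasisLabel N T Q ≃ Fin T × (Finset (Fin N) × Fin N × Fin Q) :=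
    ⟨fun b => (b.2.1, b.1, b.2.2.1, b.2.2.2), fun x => (x.2.1, x.1, x.2.2.1, x.2.2.2),
      fun _ => rfl, fun _ => rfl⟩
  -- The block mixes labels `t` at fixed `β`; it acts as the diffusion on `u` only if `β` is
  -- disentangled from `t`, hence the constant `c`.
  obtain ⟨V, hV⟩ := exists_unitary_block e fun y => if k < (y.2.2 : ℕ) then diffusion T hT else 1
  refine ⟨V, fun S c u => ?_⟩
  funext b
  rw [hV]
  simp only [e, branchState, Equiv.coe_fn_mk, Equiv.coe_fn_symm_mk]
  by_cases h : b.1 = S ∧ b.2.2.1 = c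
  · simp only [h, and_self, if_true]
    by_cases hk : k < (b.2.2.2 : ℕ)
    · simp only [hk, if_true, diffusion_apply]
    · simp [hk, one_apply]
  · simp only [h, if_false, mul_zero, Finset.sum_const_zero]

/-- The phase `-1` on labels `β ∈ R` with workspace label exceeding `k`, followed by
`β ↦ -β`. -/
theorem exists_phase_gate (N T Q : ℕ) [NeZero N] (R : Finset (Fin N)) (k : ℕ) :
    ∃ V : Matrix.unitaryGroup (BasisLabel N T Q) ℂ, ∀ (S : Finset (Fin N)) (f : Fin T → Fin N)
      (u : Fin Q → Fin T → ℂ), V.1.mulVec (branchState S f u) =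
        branchState S (fun t => -f t) fun w t =>
          (if k < (w : ℕ) ∧ f t ∈ R then -1 else 1) * u w t := by
  let σ : Equiv.Perm (BasisLabel N T Q) :=
    ⟨fun b => (b.1, b.2.1, -b.2.2.1, b.2.2.2), fun b => (b.1, b.2.1, -b.2.2.1, b.2.2.2),
      fun b => by simp, fun b => by simp⟩
  obtain ⟨V, hV⟩ := exists_unitary_perm σ
    -- The new label `β` reads the old label `-β`, which is the one to test. Negating turns `O S t`
    -- into `-O S t`, so that the next query uncomputes it without an inverse oracle.
    (fun b => if k < (b.2.2.2 : ℕ) ∧ -b.2.2.1 ∈ R then -1 else 1)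
    (fun b => by split_ifs <;> simp)
  refine ⟨V, fun S f u => ?_⟩
  funext b
  rw [hV]
  simp only [σ, branchState, Equiv.coe_fn_mk, neg_eq_iff_eq_neg]
  by_cases h : b.1 = S ∧ b.2.2.1 = -f b.2.1
  · simp only [h, and_self, if_true, neg_neg]
  · simp only [h, if_false, mul_zero]

/-- The total mass of a branch state over a set of workspace labels. -/
theorem sum_branchState {N T Q : ℕ} (S : Finset (Fin N)) (f : Fin T → Fin N)
    (u : Fin Q → Fin T → ℂ) (P : Fin Q → Prop) [DecidablePred P] :
    ∑ b : BasisLabel N T Q, (if P b.2.2.2 then ‖branchState S f u b‖ ^ 2 else 0) =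
      ∑ y, if P y then ∑ t, ‖u y t‖ ^ 2 else 0 := by
  have h1 : ∀ (s : Finset (Fin N)) (t : Fin T) (β : Fin N) (y : Fin Q),
      (if P y then ‖branchState S f u (s, t, β, y)‖ ^ 2 else 0) =
        if s = S then if β = f t then if P y then ‖u y t‖ ^ 2 else 0 else 0 else 0 := by
    intro s t β y
    by_cases hs : s = S <;> by_cases hβ : β = f t <;> simp [branchState, hs, hβ]
  simp only [Fintype.sum_prod_type, h1]
  rw [Finset.sum_eq_single S (fun s _ hs => by simp [hs]) (by simp)]
  have h2 : ∀ t : Fin T, ∑ β : Fin N, ∑ y : Fin Q, (if β = f t then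
      if P y then ‖u y t‖ ^ 2 else 0 else 0) = ∑ y, if P y then ‖u y t‖ ^ 2 else 0 := by
    intro t
    rw [Finset.sum_eq_single (f t) (fun β _ hβ => by simp [hβ]) (by simp)]
    simp
  simp only [if_true, h2]
  rw [Finset.sum_comm]
  refine Finset.sum_congr rfl fun y _ => ?_
  split_ifs <;> simp

/-! ### Grover rotation and its spectrum -/

/-- Amplitudes, relative to the uniform superposition, of the marked and the unmarked labels after
`j` Grover steps, when a fraction `p` of the labels is marked. -/
noncomputable def groverAmp (p : ℝ) : ℕ → ℝ × ℝ
  | 0 => (1, 1)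
  | j + 1 => (2 * (-p * (groverAmp p j).1 + (1 - p) * (groverAmp p j).2) + (groverAmp p j).1,
      2 * (-p * (groverAmp p j).1 + (1 - p) * (groverAmp p j).2) - (groverAmp p j).2)

/-- In the plane of marked and unmarked superpositions, a Grover step is a rotation by `2θ`. Stating
it with products covers `sin θ = 0` and `cos θ = 0`. -/
theorem groverAmp_trig (θ : ℝ) (j : ℕ) :
    Real.sin θ * (groverAmp (Real.sin θ ^ 2) j).1 = Real.sin ((2 * j + 1) * θ) ∧
      Real.cos θ * (groverAmp (Real.sin θ ^ 2) j).2 = Real.cos ((2 * j + 1) * θ) := by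
  induction j with
  | zero => simp [groverAmp]
  | succ j ih =>
    obtain ⟨h1, h2⟩ := ih
    have hc := Real.sin_sq_add_cos_sq θ
    have e : (2 * ((j + 1 : ℕ) : ℝ) + 1) * θ = (2 * j + 1) * θ + 2 * θ := by push_cast; ring
    rw [e, Real.sin_add, Real.cos_add, ← h1, ← h2, Real.sin_two_mul, Real.cos_two_mul]
    have hc2 : Real.cos θ ^ 2 = 1 - Real.sin θ ^ 2 := by linarith
    simp only [groverAmp]
    constructor
    · rw [hc2]; linear_combination
        (-2 * Real.sin θ * (groverAmp (Real.sin θ ^ 2) j).2) * hc2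
    · linear_combination
        (-2 * Real.cos θ * (groverAmp (Real.sin θ ^ 2) j).2) * hc2

/-- The joint amplitude of the workspace label `w` and the label `t` after `i` controlled Grover
steps with window `a`. -/
noncomputable def countingAmp {T Q : ℕ} (a : Fin Q → ℝ) (p : ℝ) (mk : Fin T → Prop) [DecidablePred mk] (i : ℕ)
    (w : Fin Q) (t : Fin T) : ℂ :=
  (a w * (√(T : ℝ))⁻¹ * (if mk t then (groverAmp p (min i w)).1
    else (groverAmp p (min i w)).2) : ℝ)

/-- One controlled Grover step. -/
theorem countingAmp_succ {T Q : ℕ} (hT : 0 < T) (a : Fin Q → ℝ) (p : ℝ) (mk : Fin T → Prop)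
    [DecidablePred mk] (hp : p = ((Finset.univ.filter mk).card : ℝ) / T) (i : ℕ)
    (w : Fin Q) (t : Fin T) :
    (if i < (w : ℕ) then 2 / (T : ℂ) *
        ∑ x, (if i < (w : ℕ) ∧ mk x then -1 else 1) * countingAmp a p mk i w x -
        (if i < (w : ℕ) ∧ mk t then -1 else 1) * countingAmp a p mk i w t
      else (if i < (w : ℕ) ∧ mk t then -1 else 1) * countingAmp a p mk i w t) =
      countingAmp a p mk (i + 1) w t := by
  have hT' : (T : ℝ) ≠ 0 := by exact_mod_cast hT.ne'
  by_cases h : i < (w : ℕ)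
  · have e1 : min i (w : ℕ) = i := min_eq_left h.le
    have e2 : min (i + 1) (w : ℕ) = i + 1 := min_eq_left h
    simp only [h, true_and, if_true, countingAmp, e1, e2, groverAmp]
    set α := (groverAmp p i).1
    set β := (groverAmp p i).2
    have hs : ∑ x : Fin T, (if mk x then (-1 : ℂ) else 1) *
        ((a w * (√(T : ℝ))⁻¹ * (if mk x then α else β) : ℝ) : ℂ) =
        ((a w * (√(T : ℝ))⁻¹ * (T * (-p * α + (1 - p) * β)) : ℝ) : ℂ) := by
      have : ∀ x : Fin T, (if mk x then (-1 : ℂ) else 1) *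
          ((a w * (√(T : ℝ))⁻¹ * (if mk x then α else β) : ℝ) : ℂ) =
          ((a w * (√(T : ℝ))⁻¹ * (β - (if mk x then α + β else 0)) : ℝ) : ℂ) := by
        intro x; split_ifs <;> push_cast <;> ring
      rw [Finset.sum_congr rfl fun x _ => this x, ← Complex.ofReal_sum, ← Finset.mul_sum,
        Finset.sum_sub_distrib, ← Finset.sum_filter]
      simp only [Finset.sum_const, Finset.card_univ, Fintype.card_fin, nsmul_eq_mul]
      rw [hp]
      congr 2
      field_simp
      ring
    rw [hs]
    have hTc : (T : ℂ) ≠ 0 := by exact_mod_cast hT.ne'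
    split_ifs <;> push_cast <;> field_simp <;> ring
  · have e1 : min i (w : ℕ) = w := min_eq_right (by omega)
    have e2 : min (i + 1) (w : ℕ) = w := min_eq_right (by omega)
    simp only [h, false_and, if_false, one_mul, countingAmp, e1, e2]

theorem sum_norm_sq_countingAmp_zero {T Q : ℕ} (hT : 0 < T) (a : Fin Q → ℝ)
    (ha : ∑ j, a j ^ 2 = 1) : ∑ w : Fin Q, ∑ _t : Fin T,
      ‖((a w * (√(T : ℝ))⁻¹ : ℝ) : ℂ)‖ ^ 2 = 1 := by
  have hT' : (0 : ℝ) < T := by exact_mod_cast hT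
  simp only [Complex.norm_real, Real.norm_eq_abs, sq_abs, mul_pow, inv_pow, Real.sq_sqrt hT'.le,
    Finset.sum_const, Finset.card_univ, Fintype.card_fin, nsmul_eq_mul]
  rw [← ha]
  refine Finset.sum_congr rfl fun j _ => ?_
  field_simp

/-- The mass of the workspace label `y` after the Fourier transform. -/
theorem sum_norm_sq_fourier {T Q : ℕ} (hT : 0 < T) (hQ : 0 < Q) (a : Fin Q → ℝ) (θ : ℝ)
    (mk : Fin T → Prop) [DecidablePred mk]
    (hp : Real.sin θ ^ 2 = ((Finset.univ.filter mk).card : ℝ) / T) (h : ℕ)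
    (ha : ∀ j : Fin Q, h < j → a j = 0) (y : Fin Q) :
    2 * ∑ t : Fin T, ‖(fourier Q hQ).1.mulVec
        (fun w => countingAmp a (Real.sin θ ^ 2) mk h w t) y‖ ^ 2 =
      ‖(fourier Q hQ).1.mulVec (fun j => (a j : ℂ) *
        Complex.exp (((2 * θ : ℝ) : ℂ) * Complex.I) ^ (j : ℕ)) y‖ ^ 2 +
      ‖(fourier Q hQ).1.mulVec (fun j => (a j : ℂ) *
        Complex.exp (((2 * (-θ) : ℝ) : ℂ) * Complex.I) ^ (j : ℕ)) y‖ ^ 2 := by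
  have hT' : (0 : ℝ) < T := by exact_mod_cast hT
  set p := Real.sin θ ^ 2 with hpdef
  set X : ℂ := (fourier Q hQ).1.mulVec (fun w => ((a w * (groverAmp p w).1 : ℝ) : ℂ)) y with hX
  set Y : ℂ := (fourier Q hQ).1.mulVec (fun w => ((a w * (groverAmp p w).2 : ℝ) : ℂ)) y with hY
  have hterm : ∀ t : Fin T, ‖(fourier Q hQ).1.mulVec (fun w => countingAmp a p mk h w t) y‖ ^ 2 =
      (T : ℝ)⁻¹ * (‖Y‖ ^ 2 + if mk t then ‖X‖ ^ 2 - ‖Y‖ ^ 2 else 0) := by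
    intro t
    have h1 : (fun w => countingAmp a p mk h w t) = ((√(T : ℝ) : ℝ) : ℂ)⁻¹ • fun w : Fin Q =>
        ((a w * (if mk t then (groverAmp p w).1 else (groverAmp p w).2) : ℝ) : ℂ) := by
      funext w
      simp only [countingAmp, Pi.smul_apply, smul_eq_mul]
      by_cases hw : h < (w : ℕ)
      · simp [ha w hw]
      · rw [min_eq_right (by omega)]
        push_cast; ring
    rw [h1, mulVec_smul, Pi.smul_apply, smul_eq_mul, norm_mul, mul_pow, norm_sq_inv_sqrt _ hT'.le]
    split_ifs
    · rw [← hX]; ring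
    · rw [← hY]; ring
  have hsum : ∑ t : Fin T, ‖(fourier Q hQ).1.mulVec (fun w => countingAmp a p mk h w t) y‖ ^ 2 =
      ‖(Real.sin θ : ℂ) * X‖ ^ 2 + ‖(Real.cos θ : ℂ) * Y‖ ^ 2 := by
    rw [Finset.sum_congr rfl fun t _ => hterm t, ← Finset.mul_sum, Finset.sum_add_distrib,
      ← Finset.sum_filter]
    simp only [Finset.sum_const, Finset.card_univ, Fintype.card_fin, nsmul_eq_mul]
    have hK : ((Finset.univ.filter mk).card : ℝ) = p * T := by rw [hp]; field_simp
    have hc : Real.cos θ ^ 2 = 1 - p := by rw [hpdef, Real.cos_sq']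
    rw [hK, norm_mul, norm_mul, mul_pow, mul_pow, Complex.norm_real, Complex.norm_real,
      Real.norm_eq_abs, Real.norm_eq_abs, sq_abs, sq_abs, hc, ← hpdef]
    field_simp
    ring
  -- `X` and `Y` carry the sines and cosines of `(2 j + 1) θ`; recombined, they give the
  -- exponentials of frequency `±θ`, up to a global phase.
  have hE : ∀ s : ℝ, (s = 1 ∨ s = -1) → Complex.exp ((s * θ : ℝ) * Complex.I) *
      (fourier Q hQ).1.mulVec (fun j => (a j : ℂ) *
        Complex.exp (((2 * (s * θ) : ℝ) : ℂ) * Complex.I) ^ (j : ℕ)) y =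
      (Real.cos θ : ℂ) * Y + s * Complex.I * ((Real.sin θ : ℂ) * X) := by
    intro s hs
    rw [hX, hY]
    simp only [mulVec, dotProduct, Finset.mul_sum, ← Finset.sum_add_distrib]
    refine Finset.sum_congr rfl fun j _ => ?_
    obtain ⟨g1, g2⟩ := groverAmp_trig θ j
    have e1 : Complex.exp ((s * θ : ℝ) * Complex.I) *
        Complex.exp (((2 * (s * θ) : ℝ) : ℂ) * Complex.I) ^ (j : ℕ) =
        (Real.cos ((2 * (j : ℕ) + 1) * θ) : ℂ) +
          s * Complex.I * (Real.sin ((2 * (j : ℕ) + 1) * θ) : ℂ) := by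
      rw [← Complex.exp_nat_mul, ← Complex.exp_add]
      have : ((s * θ : ℝ) : ℂ) * Complex.I + ((j : ℕ) : ℂ) * (((2 * (s * θ) : ℝ) : ℂ) * Complex.I) =
          ((s * ((2 * (j : ℕ) + 1) * θ) : ℝ) : ℂ) * Complex.I := by push_cast; ring
      rw [this, Complex.exp_mul_I, ← Complex.ofReal_cos, ← Complex.ofReal_sin]
      rcases hs with rfl | rfl
      · simp only [one_mul, Complex.ofReal_one]; ring
      · simp only [neg_mul, one_mul, Complex.ofReal_neg, Complex.ofReal_one, Real.cos_neg,
          Real.sin_neg]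
        ring
    rw [← g1, ← g2] at e1
    push_cast at e1 ⊢
    linear_combination ((fourier Q hQ).1 y j * a j) * e1
  have hE1 := hE 1 (Or.inl rfl)
  have hE2 := hE (-1) (Or.inr rfl)
  have n1 := congrArg (fun z => ‖z‖) hE1
  have n2 := congrArg (fun z => ‖z‖) hE2
  simp only [norm_mul, Complex.norm_exp_ofReal_mul_I, one_mul] at n1
  rw [norm_mul, Complex.norm_exp_ofReal_mul_I, one_mul] at n2
  rw [neg_one_mul] at n2
  rw [n1, n2, hsum]
  -- The parallelogram law converts the sum of the marked and unmarked masses into the average over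
  -- both frequencies.
  have := parallelogram_law_with_norm ℝ ((Real.cos θ : ℂ) * Y)
    (Complex.I * ((Real.sin θ : ℂ) * X))
  simp only [norm_mul, Complex.norm_I, one_mul] at this
  have e3 : (Real.cos θ : ℂ) * Y + ((1 : ℝ) : ℂ) * Complex.I * ((Real.sin θ : ℂ) * X) =
    (Real.cos θ : ℂ) * Y + Complex.I * ((Real.sin θ : ℂ) * X) := by push_cast; ring
  have e4 : (Real.cos θ : ℂ) * Y + ((-1 : ℝ) : ℂ) * Complex.I * ((Real.sin θ : ℂ) * X) =
    (Real.cos θ : ℂ) * Y - Complex.I * ((Real.sin θ : ℂ) * X) := by push_cast; ring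
  rw [e4]
  simp only [Complex.ofReal_one, one_mul, norm_mul]
  nlinarith [this]

/-! ### The amplitude estimation algorithm -/

/-- Amplitude estimation with `M` queries: the outcome probabilities on the workspace. -/
theorem exists_counting_algorithm (N T M Q : ℕ) [NeZero N] (hT : 0 < T) (hQ : 0 < Q)
    (S R : Finset (Fin N)) (a : Fin Q → ℝ) (ha : ∑ j, a j ^ 2 = 1)
    (ha' : ∀ j : Fin Q, M / 2 < j → a j = 0) (out : Fin Q → ℝ) :
    ∃ A : Algorithm N T M, ∀ (O : Finset (Fin N) → Fin T → Fin N) (θ : ℝ),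
      Real.sin θ ^ 2 = ((Finset.univ.filter fun t => O S t ∈ R).card : ℝ) / T →
      ∀ (E : Set ℝ) [DecidablePred (· ∈ E)], 2 * A.prob O E =
        (∑ y, if out y ∈ E then ‖(fourier Q hQ).1.mulVec (fun j => (a j : ℂ) *
          Complex.exp (((2 * θ : ℝ) : ℂ) * Complex.I) ^ (j : ℕ)) y‖ ^ 2 else 0) +
        ∑ y, if out y ∈ E then ‖(fourier Q hQ).1.mulVec (fun j => (a j : ℂ) *
          Complex.exp (((2 * (-θ) : ℝ) : ℂ) * Complex.I) ^ (j : ℕ)) y‖ ^ 2 else 0 := by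
  classical
  set init : BasisLabel N T Q := (S, ⟨0, hT⟩, 0, ⟨0, hQ⟩)
  obtain ⟨G, hG⟩ := exists_unitary_column init
    (branchState S (fun _ => 0) fun w (_ : Fin T) => ((a w * (√(T : ℝ))⁻¹ : ℝ) : ℂ)) (by
      have := sum_branchState (N := N) S (fun _ : Fin T => 0)
        (fun (w : Fin Q) (_ : Fin T) => ((a w * (√(T : ℝ))⁻¹ : ℝ) : ℂ)) (fun _ => True)
      simp only [if_true] at this
      rw [this, sum_norm_sq_countingAmp_zero hT a ha])
  choose P hP using exists_phase_gate N T Q R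
  choose V hV using exists_diffusion_gate N T Q hT
  obtain ⟨F, hF⟩ := exists_fourier_gate N T Q hQ
  -- After the preparation, gates `2 i + 1` and `2 i + 2` are the phase and the diffusion of Grover
  -- step `i`, each preceded by a query.
  let g : ℕ → Matrix.unitaryGroup (BasisLabel N T Q) ℂ := fun k =>
    if k = 0 then G else if k % 2 = 1 then P (k / 2) else V (k / 2 - 1)
  obtain ⟨g', hg'⟩ := exists_algorithm_postcompose (M := M) init g F fun b => out b.2.2.2
  refine ⟨⟨Q, init, g', fun b => out b.2.2.2⟩, fun O θ hθ E _ => ?_⟩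
  set p := Real.sin θ ^ 2 with hp
  set A₀ : Algorithm N T M := ⟨Q, init, g, fun b => out b.2.2.2⟩ with hA₀
  have hstep : ∀ k ψ, A₀.stateAfter O k = ψ →
      A₀.stateAfter O (k + 1) = (g (k + 1)).1.mulVec ((oracleMatrix O).mulVec ψ) := by
    rintro k _ rfl
    rfl
  have hzero : A₀.stateAfter O 0 = (g 0).1.mulVec (Pi.single init 1) := rfl
  have hodd : ∀ i, A₀.stateAfter O (2 * i) =
      branchState S (fun _ => 0) (countingAmp a p (fun t => O S t ∈ R) i) →
      A₀.stateAfter O (2 * i + 1) = branchState S (fun t => -O S t) fun w t =>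
        (if i < (w : ℕ) ∧ O S t ∈ R then -1 else 1) *
          countingAmp a p (fun t => O S t ∈ R) i w t := by
    intro i hi
    have hgi : g (2 * i + 1) = P i := by
      have e1 : (2 * i + 1) % 2 = 1 := by omega
      have e2 : (2 * i + 1) / 2 = i := by omega
      simp [g, e1, e2]
    rw [hstep _ _ hi, hgi, oracleMatrix_mulVec, hP]
    simp only [zero_add]
  have heven : ∀ i, A₀.stateAfter O (2 * i) =
      branchState S (fun _ => 0) (countingAmp a p (fun t => O S t ∈ R) i) := by
    intro i
    induction i with
    | zero =>
      have hg0 : g 0 = G := by simp [g]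
      rw [Nat.mul_zero, hzero, hg0, hG]
      congr 1
      funext w t
      simp [countingAmp, groverAmp]
    | succ i ih =>
      have hgi : g (2 * i + 1 + 1) = V i := by
        have e1 : (2 * i + 1 + 1) % 2 ≠ 1 := by omega
        have e2 : (2 * i + 1 + 1) / 2 - 1 = i := by omega
        simp only [g, if_neg e1, e2, Nat.succ_ne_zero, if_false]
      rw [show 2 * (i + 1) = 2 * i + 1 + 1 by ring, hstep _ _ (hodd i ih), hgi,
        oracleMatrix_mulVec]
      simp only [neg_add_cancel]
      rw [hV]
      congr 1
      funext w t
      exact countingAmp_succ hT a p (fun t => O S t ∈ R) hθ i w t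
  -- For odd `M` the last query is idle: its phase acts only where the window vanishes, and the
  -- leftover value in `β` does not affect the workspace statistics.
  have hfin : ∃ f : Fin T → Fin N, A₀.stateAfter O M =
      branchState S f (countingAmp a p (fun t => O S t ∈ R) (M / 2)) := by
    rcases Nat.mod_two_eq_zero_or_one M with hM | hM
    · refine ⟨fun _ => 0, ?_⟩
      rw [← heven, show 2 * (M / 2) = M by omega]
    · refine ⟨fun t => -O S t, ?_⟩
      have := hodd (M / 2) (heven _)
      rw [show 2 * (M / 2) + 1 = M by omega] at this
      rw [this]
      congr 1
      funext w t
      by_cases hw : M / 2 < (w : ℕ)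
      · simp [countingAmp, ha' w hw]
      · simp [hw]
  obtain ⟨f, hf⟩ := hfin
  have hprob : (Algorithm.mk Q init g' (fun b => out b.2.2.2) : Algorithm N T M).prob O E =
      ∑ y, if out y ∈ E then ∑ t, ‖(fourier Q hQ).1.mulVec
        (fun w => countingAmp a p (fun t => O S t ∈ R) (M / 2) w t) y‖ ^ 2 else 0 := by
    rw [Algorithm.prob, hg', hf, hF, ← sum_branchState S f _ (fun y => out y ∈ E)]
    refine Finset.sum_congr rfl fun b _ => ?_
    simp only [Set.indicator_apply, Set.mem_preimage]
  rw [hprob, Finset.mul_sum, ← Finset.sum_add_distrib]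
  refine Finset.sum_congr rfl fun y _ => ?_
  split_ifs
  · exact sum_norm_sq_fourier hT hQ a θ _ hθ (M / 2) ha' y
  · simp

/-! ### From the outcome to the relative error -/

/-- The conditional weight of `R ⊆ S` is the fraction of labels `t` with `O S t ∈ R`. -/
theorem weight_condDist {N T : ℕ} {O : Finset (Fin N) → Fin T → Fin N} {D : Fin N → ℝ}
    (hO : Represents O D) (S R : Finset (Fin N)) (hS : 0 < weight D S) :
    weight (condDist D S) R = ((Finset.univ.filter fun t => O S t ∈ R).card : ℝ) / T := by
  rw [weight, Finset.sum_congr rfl fun i _ => hO S hS i, ← Finset.sum_div, ← Nat.cast_sum]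
  congr 2
  rw [Finset.card_eq_sum_card_fiberwise (f := fun t => O S t) (t := R) (by intro t; simp)]
  refine Finset.sum_congr rfl fun i hi => congrArg _ ?_
  ext t
  simp only [Finset.mem_filter, Finset.mem_univ, true_and]
  exact ⟨fun h => ⟨h ▸ hi, h⟩, fun h => h.2⟩

/-- One factor of `sin (x - θ) sin (x + θ)` is at most `r`; the other differs from it by a shift of
`2θ`, so it is at most `r + 2 sin θ ≤ 3 sin θ`. Only sines are used, so `x` matters modulo `π` and
either sign of `θ` is allowed. -/
theorem sin_sq_mem_Icc {x θ r ε : ℝ} (hθ : 0 ≤ Real.sin θ) (hε1 : ε ≤ 1)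
    (hr : 3 * r ≤ ε * Real.sin θ)
    (hx : |Real.sin (x - θ)| ≤ r ∨ |Real.sin (x - -θ)| ≤ r) :
    Real.sin x ^ 2 ∈ Set.Icc ((1 - ε) * Real.sin θ ^ 2) ((1 + ε) * Real.sin θ ^ 2) := by
  have hprod : Real.sin x ^ 2 - Real.sin θ ^ 2 = Real.sin (x - θ) * Real.sin (x - -θ) := by
    rw [sub_neg_eq_add, Real.sin_add, Real.sin_sub]
    have h1 := Real.sin_sq_add_cos_sq x
    have h2 := Real.sin_sq_add_cos_sq θ
    linear_combination (Real.sin θ ^ 2) * h1 - (Real.sin x ^ 2) * h2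
  have hadd : ∀ u v : ℝ, |Real.sin (u + v)| ≤ |Real.sin u| + |Real.sin v| := by
    intro u v
    rw [Real.sin_add]
    refine (abs_add_le _ _).trans ?_
    rw [abs_mul, abs_mul]
    have h1 := Real.abs_cos_le_one u
    have h2 := Real.abs_cos_le_one v
    have h3 := abs_nonneg (Real.sin u)
    have h4 := abs_nonneg (Real.sin v)
    nlinarith
  have h2θ : ∀ u : ℝ, |Real.sin (u + θ + θ)| ≤ |Real.sin u| + 2 * Real.sin θ := by
    intro u
    have h1 := hadd (u + θ) θ
    have h2 := hadd u θ
    rw [abs_of_nonneg hθ] at h1 h2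
    linarith
  have hbound : |Real.sin x ^ 2 - Real.sin θ ^ 2| ≤ r * (r + 2 * Real.sin θ) := by
    rw [hprod, abs_mul]
    rcases hx with hx | hx
    · have h := h2θ (x - θ)
      rw [show x - θ + θ + θ = x - -θ by ring] at h
      have := abs_nonneg (Real.sin (x - θ))
      gcongr <;> linarith
    · have h := h2θ (-(x - -θ))
      rw [show -(x - -θ) + θ + θ = -(x - θ) by ring, Real.sin_neg, Real.sin_neg, abs_neg,
        abs_neg] at h
      have := abs_nonneg (Real.sin (x - -θ))
      rw [mul_comm]
      gcongr <;> linarith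
  have hr0 : 0 ≤ r := by
    rcases hx with hx | hx <;> exact (abs_nonneg _).trans hx
  have hfin : r * (r + 2 * Real.sin θ) ≤ ε * Real.sin θ ^ 2 := by
    have h1 : r + 2 * Real.sin θ ≤ 3 * Real.sin θ := by nlinarith
    calc r * (r + 2 * Real.sin θ) ≤ r * (3 * Real.sin θ) := by gcongr
      _ = 3 * r * Real.sin θ := by ring
      _ ≤ ε * Real.sin θ * Real.sin θ := by gcongr
      _ = _ := by ring
  have := abs_le.1 (hbound.trans hfin)
  constructor <;> nlinarith

end QCond

theorem mainTheorem10 :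
    ∃ c : ℝ, 0 < c ∧
      ∀ (N T : ℕ), 0 < N → 0 < T →
      ∀ (S R : Finset (Fin N)), R ⊆ S →
      ∀ (M : ℕ) (δ : ℝ), 0 < δ → δ ≤ 1 →
      ∃ A : QCond.Algorithm N T M,
        ∀ (D : Fin N → ℝ), D ∈ stdSimplex ℝ (Fin N) →
        ∀ (O : Finset (Fin N) → Fin T → Fin N), QCond.Represents O D →
          0 < QCond.weight D S →
          0 < QCond.weight (QCond.condDist D S) R →
          ∀ ε : ℝ, 0 < ε → ε ≤ 1 →
            (M : ℝ) ≥ c * Real.log (1 / δ) /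
              (ε * Real.sqrt (QCond.weight (QCond.condDist D S) R)) →
            A.prob O (Set.Icc ((1 - ε) * QCond.weight (QCond.condDist D S) R)
              ((1 + ε) * QCond.weight (QCond.condDist D S) R)) ≥ 1 - δ := by
  classical
  refine ⟨600, by norm_num, fun N T hN hT S R _ M δ hδ hδ1 => ?_⟩
  have : NeZero N := ⟨hN.ne'⟩
  -- For `δ = 1` any algorithm works, as probabilities are nonnegative.
  rcases hδ1.eq_or_lt with rfl | hδ1
  · refine ⟨⟨1, (S, ⟨0, hT⟩, 0, 0), fun _ => 1, fun _ => 0⟩, fun D _ O _ _ _ ε _ _ _ => ?_⟩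
    rw [sub_self]
    exact Finset.sum_nonneg fun b _ => Set.indicator_nonneg (fun _ _ => by positivity) _
  have hL : 0 < Real.log (1 / δ) := Real.log_pos (by rw [lt_div_iff₀ hδ]; linarith)
  -- With `δ < 1` the required number of queries is positive, so `M = 0` never meets the hypothesis.
  rcases Nat.eq_zero_or_pos M with rfl | hM
  · refine ⟨⟨1, (S, ⟨0, hT⟩, 0, 0), fun _ => 1, fun _ => 0⟩, fun D _ O _ _ hp ε hε _ hq => ?_⟩
    have : 0 < 600 * Real.log (1 / δ) /
        (ε * Real.sqrt (QCond.weight (QCond.condDist D S) R)) := by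
      have := Real.sqrt_pos.2 hp
      positivity
    rw [Nat.cast_zero] at hq
    linarith
  obtain ⟨Q, hQ, a, ha, ha', hwin⟩ := QCond.exists_window M hM δ hδ hδ1
  obtain ⟨A, hA⟩ := QCond.exists_counting_algorithm N T M Q hT hQ S R a ha ha'
    fun y => Real.sin (Real.pi * (y : ℕ) / Q) ^ 2
  refine ⟨A, fun D _ O hO hS hp ε hε hε1 hq => ?_⟩
  have hw := QCond.weight_condDist hO S R hS
  set p := QCond.weight (QCond.condDist D S) R with hpdef
  have hp1 : p ≤ 1 := by
    rw [hw]
    refine div_le_one_of_le₀ ?_ (Nat.cast_nonneg T)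
    exact_mod_cast (Finset.card_filter_le _ _).trans_eq (by simp)
  have hs := Real.sqrt_pos.2 hp
  set θ := Real.arcsin (√p) with hθ
  have hsin : Real.sin θ = √p :=
    Real.sin_arcsin (by linarith) (Real.sqrt_le_one.2 hp1)
  have hsin2 : Real.sin θ ^ 2 = p := by rw [hsin, Real.sq_sqrt hp.le]
  have hM' : (0 : ℝ) < M := by exact_mod_cast hM
  have hr : 3 * (200 * Real.log (1 / δ) / M) ≤ ε * Real.sin θ := by
    rw [ge_iff_le, div_le_iff₀ (by positivity)] at hq
    rw [hsin, mul_div_assoc', div_le_iff₀ hM']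
    linarith
  have hmem : ∀ x : ℝ, (|Real.sin (x - θ)| ≤ 200 * Real.log (1 / δ) / M ∨
      |Real.sin (x - -θ)| ≤ 200 * Real.log (1 / δ) / M) →
      Real.sin x ^ 2 ∈ Set.Icc ((1 - ε) * p) ((1 + ε) * p) := by
    intro x hx
    have := QCond.sin_sq_mem_Icc (hsin ▸ hs.le) hε1 hr hx
    rwa [hsin2] at this
  have h2 := hA O θ (hsin2.trans hw) (Set.Icc ((1 - ε) * p) ((1 + ε) * p))
  -- The window condition is used at both frequencies; averaging the two bounds gives the claim.
  have hmono : ∀ φ : ℝ, (φ = θ ∨ φ = -θ) → 1 - δ ≤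
      ∑ y : Fin Q, if Real.sin (Real.pi * (y : ℕ) / Q) ^ 2 ∈ Set.Icc ((1 - ε) * p) ((1 + ε) * p)
        then ‖(QCond.fourier Q hQ).1.mulVec (fun j => (a j : ℂ) *
          Complex.exp (((2 * φ : ℝ) : ℂ) * Complex.I) ^ (j : ℕ)) y‖ ^ 2 else 0 := by
    intro φ hφ
    refine (hwin φ).trans (Finset.sum_le_sum fun y _ => ?_)
    by_cases hc : |Real.sin (Real.pi * (y : ℕ) / Q - φ)| ≤ 200 * Real.log (1 / δ) / M
    · have : Real.sin (Real.pi * (y : ℕ) / Q) ^ 2 ∈ Set.Icc ((1 - ε) * p) ((1 + ε) * p) := by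
        apply hmem
        rcases hφ with rfl | rfl
        · exact Or.inl hc
        · exact Or.inr hc
      rw [if_pos hc, if_pos this]
    · rw [if_neg hc]
      split_ifs <;> positivity
  have h3 := hmono θ (Or.inl rfl)
  have h4 := hmono (-θ) (Or.inr rfl)
  linarith
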